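/- **Setting.** Let $\Omega\subset\mathbb{R}^2$ be an open bounded polygon, with boundary a simple closed polygonal curve with edges $\Gamma_1,\dots,\Gamma_m$, let $\emptyset\neq\mathcal{D}\subseteq\{1,\dots,m\}$ and $\Gamma_{\mathcal D}=\bigcup_{i\in\mathcal D}\Gamma_i$, and let $H^1_{\mathcal D}(\Omega)$ be the space of all $v\in H^1(\Omega)$ with zero trace on $\Gamma_{\mathcal D}$. Let $q\in\mathbb{N}_0$, $\lambda>0$, $f\in L^2(\Omega)$, and $$a(v,w)=\int_\Omega\nabla v\cdot\nabla w\,dx,\qquad b(u;v)=\int_\Omega u^{2q+1}v\,dx .$$ Let $C_q>0$ be a constant with $\|v\|_{L^{2(q+1)}(\Omega)}\le C_q\|\nabla v\|_{L^2(\Omega)}$ for all $v\in H^1_{\mathcal D}(\Omega)$. For a source $h\in L^2(\Omega)$ and $U_0\in H^1_{\mathcal D}(\Omega)$ put $$\rho(h)=C_q\|h\|_{L^{2(q+1)/(2q+1)}(\Omega)},\qquad L(h,U_0)=\lambda(2q+1)C_q^{2(q+1)}\bigl(2\rho(h)+\|\nabla U_0\|_{L^2(\Omega)}\bigr)^{2q},$$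 and say that $\alpha$ is *admissible* for $(h,U_0)$ if $\alpha\in(0,1]\cap\bigl(0,\tfrac{2}{L(h,U_0)^2+1}\bigr)$. For $p=1,2,\dots$ let $\mathcal{T}_p$ be a regular (conforming) partition of $\Omega$ into finitely many triangles, let $$\mathbb{W}_{N}=\{v\in H^1_{\mathcal D}(\Omega): v|_T\in\mathbb{P}^p(T)\ \ \forall T\in\mathcal{T}_p\},\qquad N=N(p)=\dim\mathbb{W}_{N},$$ where $\mathbb{P}^k(T)$ denotes the polynomials of total degree at most $k$, and let $\mathfrak{p}=\mathfrak{p}(p)\in\mathbb{N}_0$. (No geometric refinement of the meshes, no analyticity of $f$ and no growth condition on $\mathfrak p$ is needed.) Assume that there are functions $\Pi_p(f)$ with $\Pi_p(f)|_T\in\mathbb{P}^{\mathfrak{p}}(T)$ for all $T\in\mathcal{T}_p$, and constants $C',c>0$, such that $$\|f-\Pi_p(f)\|_{L^2(\Omega)}\le C'\exp(-cN^{1/3})\qquad\forall p\ge1 .$$ For every $p\ge 1$ and $T\in\mathcal{T}_p$ let $Q_{T,\mathfrak p}$ be a quadrature rule with finitely many nodes in the closed triangle $T$ that is exact on $\mathbb{P}^{\mathfrak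 p+p}(T)$. For $p\ge1$ and $U_0\in\mathbb{W}_N$ consider the sequences $(U_n)_{n\ge 0}$ and $(\mathscr{U}_n)_{n\ge 0}$ in $\mathbb{W}_N$ with $\mathscr{U}_0=U_0$ and, for all $n\ge0$ and all $v\in\mathbb{W}_N$, $$a(U_{n+1},v)=(1-\alpha)a(U_n,v)+\alpha\Bigl(\int_\Omega fv\,dx-\lambda b(U_n;v)\Bigr),$$ $$a(\mathscr{U}_{n+1},v)=(1-\alpha)a(\mathscr{U}_n,v)-\alpha\lambda b(\mathscr{U}_n;v)+\alpha\sum_{T\in\mathcal{T}_p}Q_{T,\mathfrak p}(\Pi_p(f)v).$$ **Lemma.** For every $\alpha$ there are constants $C,\kappa>0$ and $N_0\in\mathbb{N}_0$, independent of $p$, $N$, $n$ and $U_0$, such that for all $p\ge1$ and all $U_0\in\mathbb{W}_N$ for which $\alpha$ is admissible for $(f,U_0)$, the bound $$\|\nabla(U_n-\mathscr{U}_n)\|_{L^2(\Omega)}\le C\exp(-\kappa N^{1/3})\qquad\forall n\ge0$$ holds if $N\ge N_0$, and it holds for $N<N_0$ as well if $\alpha$ is also admissible for $(\Pi_p(f),U_0)$.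 -/

import Mathlib

noncomputable section

namespace HpILG

open MeasureTheory Set
open scoped ContDiff ENNReal

/-- The Euclidean plane. -/
abbrev Plane : Type := EuclideanSpace ℝ (Fin 2)

/-! ### Polygonal domains -/

/-- The `i`-th edge of a closed polygonal curve with corners `c 0, …, c (m - 1)`; indices are
cyclic, so the last edge joins `c (m - 1)` to `c 0`. -/
def edge {m : ℕ} [NeZero m] (c : Fin m → Plane) (i : Fin m) : Set Plane :=
  segment ℝ (c i) (c (i + 1))

/-- `Ω` is an open bounded polygon with straight edges and consecutive corners `c`: its boundary
is a simple closed polygonal curve. -/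
structure IsPolygon {m : ℕ} [NeZero m] (Ω : Set Plane) (c : Fin m → Plane) : Prop where
  three_le : 3 ≤ m
  isOpen : IsOpen Ω
  isBounded : Bornology.IsBounded Ω
  injective : Function.Injective c
  simple : ∀ i j, i ≠ j → edge c i ∩ edge c j ⊆ {c i, c (i + 1)} ∩ {c j, c (j + 1)}
  frontier_eq : frontier Ω = ⋃ i, edge c i

/-- The Dirichlet part of the boundary. -/
def dirichletPart {m : ℕ} [NeZero m] (c : Fin m → Plane) (D : Finset (Fin m)) : Set Plane :=
  ⋃ i ∈ D, edge c i

/-! ### Sobolev spaces -/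

/-- Pairs `(v, G)` in `L²(Ω) × L²(Ω)²`. An element of `H¹(Ω)` is represented by the pair of the
function and its weak gradient (which the function determines). -/
abbrev L2Pair (Ω : Set Plane) : Type :=
  Lp ℝ 2 (volume.restrict Ω) × Lp Plane 2 (volume.restrict Ω)

/-- `u` agrees almost everywhere in `Ω` with the smooth, compactly supported `φ : ℝ² → ℝ`, its
second component with the gradient of `φ`, and `g` with the restriction of `φ` to `Γ` (almost
everywhere for the arc length). -/
def IsSmoothWithTrace (Ω Γ : Set Plane)
    (ug : L2Pair Ω × Lp ℝ 2 ((Measure.hausdorffMeasure 1 : Measure Plane).restrict Γ)) : Prop :=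
  ∃ φ : Plane → ℝ, ContDiff ℝ ∞ φ ∧ HasCompactSupport φ ∧
    (∀ᵐ x ∂(volume.restrict Ω), ug.1.1 x = φ x) ∧
    (∀ᵐ x ∂(volume.restrict Ω), ug.1.2 x = gradient φ x) ∧
    (∀ᵐ x ∂((Measure.hausdorffMeasure 1 : Measure Plane).restrict Γ), ug.2 x = φ x)

/-- The graph of the classical trace `φ ↦ φ|_Γ` on smooth functions, as a subspace of
`H¹(Ω) × L²(Γ)`. -/
def smoothTraceGraph (Ω Γ : Set Plane) :
    Submodule ℝ
      (L2Pair Ω × Lp ℝ 2 ((Measure.hausdorffMeasure 1 : Measure Plane).restrict Γ)) where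
  carrier := {ug | IsSmoothWithTrace Ω Γ ug}
  zero_mem' := by
    refine ⟨fun _ => 0, contDiff_const, HasCompactSupport.zero, ?_, ?_, ?_⟩
    · exact Lp.coeFn_zero ℝ 2 _
    · filter_upwards [Lp.coeFn_zero Plane 2 (volume.restrict Ω)] with x hx
      simpa [gradient] using hx
    · exact Lp.coeFn_zero ℝ 2 _
  add_mem' := by
    rintro u w ⟨φ, hφ, hφc, h1, h2, h3⟩ ⟨ψ, hψ, hψc, k1, k2, k3⟩
    refine ⟨φ + ψ, hφ.add hψ, hφc.add hψc, ?_, ?_, ?_⟩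
    · filter_upwards [h1, k1, Lp.coeFn_add u.1.1 w.1.1] with x a b e
      simpa [a, b] using e
    · filter_upwards [h2, k2, Lp.coeFn_add u.1.2 w.1.2] with x a b e
      have e' : (u + w).1.2 x = u.1.2 x + w.1.2 x := e
      rw [e', a, b]
      simp only [gradient]
      rw [fderiv_add (hφ.differentiable (by simp) x) (hψ.differentiable (by simp) x), map_add]
    · filter_upwards [h3, k3, Lp.coeFn_add u.2 w.2] with x a b e
      simpa [a, b] using e
  smul_mem' := by
    rintro r u ⟨φ, hφ, hφc, h1, h2, h3⟩
    refine ⟨r • φ, hφ.const_smul r, hφc.smul_left (f := fun _ => r), ?_, ?_, ?_⟩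
    · filter_upwards [h1, Lp.coeFn_smul r u.1.1] with x a e
      simpa [a] using e
    · filter_upwards [h2, Lp.coeFn_smul r u.1.2] with x a e
      have e' : (r • u).1.2 x = r • u.1.2 x := e
      rw [e', a]
      simp only [gradient]
      rw [fderiv_const_smul (hφ.differentiable (by simp) x)]
      simp
    · filter_upwards [h3, Lp.coeFn_smul r u.2] with x a e
      simpa [a] using e

/-- `u.2` is the weak gradient of `u.1` in `Ω`, i.e. `u.1 ∈ H¹(Ω)` with `∇ u.1 = u.2`. -/
def IsWeakGradientPair (Ω : Set Plane) (u : L2Pair Ω) : Prop :=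
  ∀ φ : Plane → ℝ, ContDiff ℝ ∞ φ → HasCompactSupport φ → tsupport φ ⊆ Ω → ∀ i : Fin 2,
    ∫ x in Ω, u.1 x * fderiv ℝ φ x (EuclideanSpace.single i 1) = -∫ x in Ω, u.2 x i * φ x

/-- `u` has zero trace on `Γ`: the trace is the continuous extension of the restriction
of smooth functions, so `(u, 0)` has to lie in the closure of its graph in `H¹(Ω) × L²(Γ)`. -/
def HasZeroTrace (Ω Γ : Set Plane) (u : L2Pair Ω) : Prop :=
  (u, 0) ∈ (smoothTraceGraph Ω Γ).topologicalClosure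

/-- A bounded function against an `L²` function on a set of finite measure: the integrability
needed to see that weak gradients form a linear space. -/
theorem integrable_mul_test {Ω : Set Plane} {v φ : Plane → ℝ}
    (hv : MemLp v 2 (volume.restrict Ω)) (hφ : Continuous φ) (hc : HasCompactSupport φ) :
    Integrable (fun x => v x * φ x) (volume.restrict Ω) :=
  hv.integrable_mul (q := 2) (hφ.memLp_of_hasCompactSupport hc)

/-- The space `H¹_D(Ω)` of functions in `H¹(Ω)` with zero trace on `Γ`. -/
def H1D (Ω Γ : Set Plane) : Submodule ℝ (L2Pair Ω) where
  carrier := {u | IsWeakGradientPair Ω u ∧ HasZeroTrace Ω Γ u}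
  zero_mem' := by
    refine ⟨?_, (smoothTraceGraph Ω Γ).topologicalClosure.zero_mem⟩
    intro φ _ _ _ i
    have h1 : (fun x => (0 : L2Pair Ω).1 x * fderiv ℝ φ x (EuclideanSpace.single i 1))
        =ᵐ[volume.restrict Ω] fun _ => 0 := by
      filter_upwards [Lp.coeFn_zero ℝ 2 (volume.restrict Ω)] with x hx
      have hx' : (0 : L2Pair Ω).1 x = 0 := hx
      rw [hx', zero_mul]
    have h2 : (fun x => (0 : L2Pair Ω).2 x i * φ x) =ᵐ[volume.restrict Ω] fun _ => 0 := by
      filter_upwards [Lp.coeFn_zero Plane 2 (volume.restrict Ω)] with x hx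
      have hx' : (0 : L2Pair Ω).2 x = 0 := hx
      rw [hx', PiLp.zero_apply, zero_mul]
    rw [integral_congr_ae h1, integral_congr_ae h2]
    simp
  add_mem' := by
    rintro u w ⟨hu, hu'⟩ ⟨hw, hw'⟩
    refine ⟨?_, by simpa [HasZeroTrace] using
      (smoothTraceGraph Ω Γ).topologicalClosure.add_mem hu' hw'⟩
    intro φ hφ hc hs i
    have hd : Continuous fun x => fderiv ℝ φ x (EuclideanSpace.single i 1) :=
      (hφ.continuous_fderiv (by simp)).clm_apply continuous_const
    have hdc : HasCompactSupport fun x => fderiv ℝ φ x (EuclideanSpace.single i 1) :=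
      hc.fderiv_apply ℝ _
    have hG : ∀ u : L2Pair Ω, MemLp (fun x => u.2 x i) 2 (volume.restrict Ω) := fun u =>
      (EuclideanSpace.proj (𝕜 := ℝ) i : Plane →L[ℝ] ℝ).comp_memLp' (Lp.memLp u.2)
    have h1 : (fun x => (u + w).1 x * fderiv ℝ φ x (EuclideanSpace.single i 1))
        =ᵐ[volume.restrict Ω] fun x => u.1 x * fderiv ℝ φ x (EuclideanSpace.single i 1)
          + w.1 x * fderiv ℝ φ x (EuclideanSpace.single i 1) := by
      filter_upwards [Lp.coeFn_add u.1 w.1] with x hx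
      have hx' : (u + w).1 x = u.1 x + w.1 x := hx
      rw [hx', add_mul]
    have h2 : (fun x => (u + w).2 x i * φ x)
        =ᵐ[volume.restrict Ω] fun x => u.2 x i * φ x + w.2 x i * φ x := by
      filter_upwards [Lp.coeFn_add u.2 w.2] with x hx
      have hx' : (u + w).2 x = u.2 x + w.2 x := hx
      rw [hx', PiLp.add_apply, add_mul]
    rw [integral_congr_ae h1, integral_congr_ae h2,
      integral_add (integrable_mul_test (Lp.memLp u.1) hd hdc)
        (integrable_mul_test (Lp.memLp w.1) hd hdc),
      integral_add (integrable_mul_test (hG u) hφ.continuous hc)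
        (integrable_mul_test (hG w) hφ.continuous hc),
      hu φ hφ hc hs i, hw φ hφ hc hs i]
    ring
  smul_mem' := by
    rintro r u ⟨hu, hu'⟩
    refine ⟨?_, by simpa [HasZeroTrace] using
      (smoothTraceGraph Ω Γ).topologicalClosure.smul_mem r hu'⟩
    intro φ hφ hc hs i
    have h1 : (fun x => (r • u).1 x * fderiv ℝ φ x (EuclideanSpace.single i 1))
        =ᵐ[volume.restrict Ω]
          fun x => r * (u.1 x * fderiv ℝ φ x (EuclideanSpace.single i 1)) := by
      filter_upwards [Lp.coeFn_smul r u.1] with x hx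
      have hx' : (r • u).1 x = r * u.1 x := hx
      rw [hx', mul_assoc]
    have h2 : (fun x => (r • u).2 x i * φ x)
        =ᵐ[volume.restrict Ω] fun x => r * (u.2 x i * φ x) := by
      filter_upwards [Lp.coeFn_smul r u.2] with x hx
      have hx' : (r • u).2 x = r • u.2 x := hx
      rw [hx', PiLp.smul_apply, smul_eq_mul, mul_assoc]
    rw [integral_congr_ae h1, integral_congr_ae h2, integral_const_mul, integral_const_mul,
      hu φ hφ hc hs i]
    ring

/-! ### The forms of the weak formulation -/

/-- `‖∇v‖` in `L²(Ω)`. -/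
def gradNorm {Ω : Set Plane} (v : L2Pair Ω) : ℝ := ‖v.2‖

/-- `a(v, w) = ∫_Ω ∇v · ∇w`. -/
def aForm {Ω : Set Plane} (v w : L2Pair Ω) : ℝ := ∫ x in Ω, inner ℝ (v.2 x) (w.2 x)

/-- `b(u; v) = ∫_Ω u ^ (2 q + 1) v`. -/
def bForm {Ω : Set Plane} (q : ℕ) (u v : L2Pair Ω) : ℝ :=
  ∫ x in Ω, (u.1 x) ^ (2 * q + 1) * v.1 x

/-- `v ↦ ∫_Ω f v`. -/
def exactLoad {Ω : Set Plane} (f : Plane → ℝ) (v : L2Pair Ω) : ℝ := ∫ x in Ω, f x * v.1 x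

/-- `Cq` is a constant of the Sobolev embedding of `H¹_D(Ω)` into `L^{2(q+1)}(Ω)`. -/
def IsSobolevConstant (Ω Γ : Set Plane) (q : ℕ) (Cq : ℝ) : Prop :=
  0 < Cq ∧ ∀ v ∈ H1D Ω Γ,
    eLpNorm (v.1 : Plane → ℝ) (2 * ((q : ℝ≥0∞) + 1)) (volume.restrict Ω)
      ≤ ENNReal.ofReal (Cq * gradNorm v)

/-- `ρ(f) = Cq ‖f‖` with the norm of `L^{2(q+1)/(2q+1)}(Ω)`. -/
def rho (Ω : Set Plane) (q : ℕ) (Cq : ℝ) (f : Plane → ℝ) : ℝ :=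
  Cq * (eLpNorm f (ENNReal.ofReal (2 * ((q : ℝ) + 1) / (2 * q + 1))) (volume.restrict Ω)).toReal

/-- `L = lam (2q+1) Cq ^ (2(q+1)) (2 ρ(f) + ‖∇U₀‖) ^ (2q)`. -/
def lipConst {Ω : Set Plane} (q : ℕ) (lam Cq : ℝ) (f : Plane → ℝ) (U₀ : L2Pair Ω) : ℝ :=
  lam * (2 * q + 1) * Cq ^ (2 * (q + 1)) * (2 * rho Ω q Cq f + gradNorm U₀) ^ (2 * q)

/-- The condition `α ∈ (0, 1] ∩ (0, 2 / (L² + 1))` for the source `f` and the initial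
guess `U₀`. -/
def StepSize {Ω : Set Plane} (q : ℕ) (lam Cq : ℝ) (f : Plane → ℝ) (U₀ : L2Pair Ω)
    (α : ℝ) : Prop :=
  0 < α ∧ α ≤ 1 ∧ α < 2 / (lipConst q lam Cq f U₀ ^ 2 + 1)

/-! ### Meshes and finite element spaces -/

/-- The closed triangle with vertex set `T`. -/
def triangle (T : Finset Plane) : Set Plane := convexHull ℝ (T : Set Plane)

/-- A regular partition of the polygon `Ω` into finitely many triangles, given by their vertex
sets: nondegenerate triangles that cover the closure of `Ω` and two of which meet in the convex
hull of their common vertices (the empty set, a vertex or a whole edge, if they differ). -/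
structure IsRegularPartition (Ω : Set Plane) (𝒯 : Finset (Finset Plane)) : Prop where
  card_eq : ∀ T ∈ 𝒯, T.card = 3
  affineIndependent : ∀ T ∈ 𝒯, AffineIndependent ℝ (fun x : T => (x : Plane))
  inter_eq : ∀ T ∈ 𝒯, ∀ T' ∈ 𝒯,
    triangle T ∩ triangle T' = convexHull ℝ ((T : Set Plane) ∩ (T' : Set Plane))
  cover : ⋃ T ∈ 𝒯, triangle T = closure Ω

/-- Point evaluation of a polynomial in two variables. -/
def polyEval (P : MvPolynomial (Fin 2) ℝ) (x : Plane) : ℝ := MvPolynomial.eval (fun i => x i) P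

/-- `u|_T` is (almost everywhere) the polynomial `P`, of total degree at most `d`. -/
def IsElementPoly (Ω : Set Plane) (T : Finset Plane) (d : ℕ) (u : Plane → ℝ)
    (P : MvPolynomial (Fin 2) ℝ) : Prop :=
  P.totalDegree ≤ d ∧ ∀ᵐ x ∂(volume.restrict Ω), x ∈ triangle T → u x = polyEval P x

open Classical in
/-- The polynomial of total degree at most `d` that represents `u|_T`, if there is one. -/
def elementPoly (Ω : Set Plane) (T : Finset Plane) (d : ℕ) (u : Plane → ℝ) :
    MvPolynomial (Fin 2) ℝ :=
  if h : ∃ P, IsElementPoly Ω T d u P then h.choose else 0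

/-- The space of all functions in `H¹_D(Ω)` that are polynomials of total degree at most `p`
on every triangle of the mesh. -/
def hpSpace (Ω Γ : Set Plane) (𝒯 : Finset (Finset Plane)) (p : ℕ) :
    Submodule ℝ (L2Pair Ω) where
  carrier := {v | v ∈ H1D Ω Γ ∧ ∀ T ∈ 𝒯, ∃ P, IsElementPoly Ω T p v.1 P}
  zero_mem' := by
    refine ⟨(H1D Ω Γ).zero_mem, fun T _ => ⟨0, by simp, ?_⟩⟩
    filter_upwards [Lp.coeFn_zero ℝ 2 (volume.restrict Ω)] with x hx _
    simpa [polyEval] using hx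
  add_mem' := by
    rintro u w ⟨hu, hu'⟩ ⟨hw, hw'⟩
    refine ⟨(H1D Ω Γ).add_mem hu hw, fun T hT => ?_⟩
    obtain ⟨P, hP, hPe⟩ := hu' T hT
    obtain ⟨R, hR, hRe⟩ := hw' T hT
    refine ⟨P + R, (MvPolynomial.totalDegree_add P R).trans (max_le hP hR), ?_⟩
    filter_upwards [hPe, hRe, Lp.coeFn_add u.1 w.1] with x h1 h2 h3 hx
    have h3' : (u + w).1 x = u.1 x + w.1 x := h3
    rw [h3', h1 hx, h2 hx]
    simp [polyEval]
  smul_mem' := by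
    rintro r u ⟨hu, hu'⟩
    refine ⟨(H1D Ω Γ).smul_mem r hu, fun T hT => ?_⟩
    obtain ⟨P, hP, hPe⟩ := hu' T hT
    refine ⟨r • P, (MvPolynomial.totalDegree_smul_le r P).trans hP, ?_⟩
    filter_upwards [hPe, Lp.coeFn_smul r u.1] with x h1 h3 hx
    have h3' : (r • u).1 x = r * u.1 x := h3
    rw [h3', h1 hx]
    simp [polyEval]

/-- The number of degrees of freedom `N = dim W_N`. -/
def dofs (Ω Γ : Set Plane) (𝒯 : Finset (Finset Plane)) (p : ℕ) : ℕ :=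
  Module.finrank ℝ (hpSpace Ω Γ 𝒯 p)

/-! ### Quadrature -/

/-- A quadrature rule on a triangle: finitely many nodes in the triangle, with weights. -/
structure QuadratureRule (T : Finset Plane) where
  nodes : Finset Plane
  weight : Plane → ℝ
  nodes_mem : ∀ x ∈ nodes, x ∈ triangle T

/-- The value of a quadrature rule. -/
def QuadratureRule.apply {T : Finset Plane} (Q : QuadratureRule T) (g : Plane → ℝ) : ℝ :=
  ∑ x ∈ Q.nodes, Q.weight x * g x

/-- The rule integrates all polynomials of total degree at most `d` exactly. -/
def QuadratureRule.IsExact {T : Finset Plane} (Q : QuadratureRule T) (d : ℕ) : Prop :=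
  ∀ P : MvPolynomial (Fin 2) ℝ, P.totalDegree ≤ d →
    Q.apply (polyEval P) = ∫ x in triangle T, polyEval P x

/-- `v ↦ ∑_T Q_T(g v)` for `g` and `v` elementwise polynomial, of degrees at most `d` and `p`;
the nodal values on `T` are those of the polynomials `g|_T` and `v|_T`. -/
def quadratureLoad {Ω : Set Plane} (𝒯 : Finset (Finset Plane))
    (Q : (T : Finset Plane) → QuadratureRule T) (d p : ℕ) (g : Plane → ℝ) (v : L2Pair Ω) : ℝ :=
  ∑ T ∈ 𝒯, (Q T).apply fun x =>
    polyEval (elementPoly Ω T d g) x * polyEval (elementPoly Ω T p v.1) x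

/-! ### The iteration -/

/-- `U 0, U 1, …` in `W` is generated by the linearized Galerkin iteration
`a(U_{n+1}, v) = (1 - α) a(U_n, v) + α (ℓ(v) - lam b(U_n; v))` for all `v` in `W`. -/
def IsILGIteration {Ω : Set Plane} (W : Submodule ℝ (L2Pair Ω)) (q : ℕ) (lam α : ℝ)
    (load : L2Pair Ω → ℝ) (U : ℕ → L2Pair Ω) : Prop :=
  (∀ n, U n ∈ W) ∧ ∀ n, ∀ v ∈ W,
    aForm (U (n + 1)) v = (1 - α) * aForm (U n) v + α * (load v - lam * bForm q (U n) v)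

/-- The approximability of `f` by `g p = Π_p(f)`, elementwise polynomial of degree at
most `d p`, on the meshes `𝒯 p`, `p ≥ 1`, at an exponential rate in `N ^ (1/3)`. -/
structure IsExpApprox (Ω Γ : Set Plane) (𝒯 : ℕ → Finset (Finset Plane)) (f : Plane → ℝ)
    (g : ℕ → Plane → ℝ) (d : ℕ → ℕ) : Prop where
  memLp : MemLp f 2 (volume.restrict Ω)
  elementwise : ∀ p, 1 ≤ p → ∀ T ∈ 𝒯 p, ∃ P, IsElementPoly Ω T (d p) (g p) P
  rate : ∃ C c : ℝ, 0 < C ∧ 0 < c ∧ ∀ p, 1 ≤ p →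
    eLpNorm (fun x => f x - g p x) 2 (volume.restrict Ω)
      ≤ ENNReal.ofReal (C * Real.exp (-c * (dofs Ω Γ (𝒯 p) p : ℝ) ^ (1 / 3 : ℝ)))

end HpILG

end

noncomputable section
namespace HpILG

open MeasureTheory Set
open scoped ContDiff ENNReal

/-! ### Hölder estimates for the nonlinearity -/

section Holder

variable {X : Type*} [MeasurableSpace X] {μ : Measure X}

/-! Quadrature integrates the elementwise polynomial source exactly (`quadratureLoad_eq_exactLoad`),
so both sequences follow the same iteration, with loads whose difference has dual norm at most ρ(f -
Π_p f), hence exponentially small. What is needed is a stability constant independent of n, the mesh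
and U₀ (`exists_stability_constant`).

One step (`gradNorm_step_sub_le`): let e be the difference of the current iterates and M a Lipschitz
constant of λb on a ball containing them. Monotonicity of t ↦ t^(2q+1) makes the functional λ(b(u;·)
- b(w;·)) nonnegative at e, which removes the cross term. The step has factor √((1-α)² + α²M²),
which is below 1 exactly when M² < 2/α - 1.

Admissibility only gives M² < 2/α - 1 with no margin, and the perturbed source may violate it. The
remedy for q ≥ 1 is the critical radius R, at which M² = 2/α - 1. Comparison with the zero sequence
gives a growth factor k in which the 2q+1 of the Lipschitz constant is absent, so that k < 1 - α/2.
Since 2ρ + ‖∇U₀‖ ≤ R, one step maps the R-ball into a ball of radius τR with τ < 1, even if ρ is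
enlarged by a fixed ε. There the contraction factor is bounded away from 1 in terms of α, q, λ and
C_q alone. For large N the perturbation of ρ is below ε; otherwise admissibility of Π_p f replaces
this. -/

theorem toReal_sobolevExponent (q : ℕ) : (2 * ((q : ℝ≥0∞) + 1)).toReal = 2 * ((q : ℝ) + 1) := by
  rw [ENNReal.toReal_mul, ENNReal.toReal_add (by simp) (by simp)]
  simp

theorem eLpNorm_sobolevExponent (q : ℕ) (u : X → ℝ) :
    eLpNorm u (2 * ((q : ℝ≥0∞) + 1)) μ
      = (∫⁻ x, ‖u x‖ₑ ^ (2 * ((q : ℝ) + 1)) ∂μ) ^ (1 / (2 * ((q : ℝ) + 1))) := by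
  rw [eLpNorm_eq_lintegral_rpow_enorm_toReal (by simp)
    (ENNReal.mul_ne_top (by simp) (by simp)), toReal_sobolevExponent]

/-- Hölder's inequality for `u ^ i * w ^ j * z * v` with `i + j = 2 q` in `L^{2(q+1)}`. -/
theorem lintegral_pow_mul_pow_mul_le {q i j : ℕ} (hij : i + j = 2 * q) {u w z v : X → ℝ}
    (hu : AEStronglyMeasurable u μ) (hw : AEStronglyMeasurable w μ)
    (hz : AEStronglyMeasurable z μ) (hv : AEStronglyMeasurable v μ) :
    ∫⁻ x, ‖u x‖ₑ ^ i * ‖w x‖ₑ ^ j * ‖z x‖ₑ * ‖v x‖ₑ ∂μ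
      ≤ eLpNorm u (2 * ((q : ℝ≥0∞) + 1)) μ ^ i * eLpNorm w (2 * ((q : ℝ≥0∞) + 1)) μ ^ j
        * eLpNorm z (2 * ((q : ℝ≥0∞) + 1)) μ * eLpNorm v (2 * ((q : ℝ≥0∞) + 1)) μ := by
  have hq : (0 : ℝ) < 2 * ((q : ℝ) + 1) := by positivity
  set s : ℝ := 2 * ((q : ℝ) + 1) with hs
  have hij' : (i : ℝ) + j = 2 * q := by exact_mod_cast hij
  -- Weighted Hölder for the s-th powers: the weights i/s, j/s, 1/s, 1/s sum to (2q + 2)/s = 1, and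
  -- weights equal to zero are allowed.
  have key := ENNReal.lintegral_prod_norm_pow_le (μ := μ) (Finset.univ : Finset (Fin 4))
    (f := ![fun x => ‖u x‖ₑ ^ s, fun x => ‖w x‖ₑ ^ s, fun x => ‖z x‖ₑ ^ s, fun x => ‖v x‖ₑ ^ s])
    (p := ![i / s, j / s, 1 / s, 1 / s])
    (by
      intro k _
      fin_cases k
      · exact hu.enorm.pow_const s
      · exact hw.enorm.pow_const s
      · exact hz.enorm.pow_const s
      · exact hv.enorm.pow_const s)
    (by
      simp only [Fin.sum_univ_four, Matrix.cons_val]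
      field_simp
      linarith)
    (by
      intro k _
      fin_cases k <;> simp <;> positivity)
  simp only [Fin.prod_univ_four, Matrix.cons_val] at key
  have e : ∀ (a : ℝ≥0∞) (k : ℕ), (a ^ s) ^ ((k : ℝ) / s) = a ^ k := fun a k => by
    rw [← ENNReal.rpow_mul, mul_div_cancel₀ _ hq.ne', ENNReal.rpow_natCast]
  have e1 : ∀ a : ℝ≥0∞, (a ^ s) ^ (1 / s) = a := fun a => by simpa using e a 1
  have e' : ∀ (a : ℝ≥0∞) (k : ℕ), a ^ ((k : ℝ) / s) = (a ^ (1 / s)) ^ k := fun a k => by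
    rw [← ENNReal.rpow_natCast, ← ENNReal.rpow_mul]
    congr 1
    ring
  simp only [e, e1] at key
  simpa only [eLpNorm_sobolevExponent, e'] using key

variable {q : ℕ}

theorem lintegral_enorm_pow_mul_le {i j : ℕ} (hij : i + j = 2 * q) {u w z v : X → ℝ}
    (hu : AEStronglyMeasurable u μ) (hw : AEStronglyMeasurable w μ)
    (hz : AEStronglyMeasurable z μ) (hv : AEStronglyMeasurable v μ) {A B C D : ℝ}
    (hA0 : 0 ≤ A) (hB0 : 0 ≤ B) (hC0 : 0 ≤ C)
    (hA : eLpNorm u (2 * ((q : ℝ≥0∞) + 1)) μ ≤ ENNReal.ofReal A)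
    (hB : eLpNorm w (2 * ((q : ℝ≥0∞) + 1)) μ ≤ ENNReal.ofReal B)
    (hC : eLpNorm z (2 * ((q : ℝ≥0∞) + 1)) μ ≤ ENNReal.ofReal C)
    (hD : eLpNorm v (2 * ((q : ℝ≥0∞) + 1)) μ ≤ ENNReal.ofReal D) :
    ∫⁻ x, ‖u x ^ i * w x ^ j * z x * v x‖ₑ ∂μ ≤ ENNReal.ofReal (A ^ i * B ^ j * C * D) := by
  simp only [enorm_mul, enorm_pow]
  refine (lintegral_pow_mul_pow_mul_le hij hu hw hz hv).trans ?_
  rw [ENNReal.ofReal_mul (by positivity), ENNReal.ofReal_mul (by positivity),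
    ENNReal.ofReal_mul (by positivity), ENNReal.ofReal_pow hA0, ENNReal.ofReal_pow hB0]
  gcongr

theorem integrable_pow_mul {i j : ℕ} (hij : i + j = 2 * q) {u w z v : X → ℝ}
    (hu : MemLp u (2 * ((q : ℝ≥0∞) + 1)) μ) (hw : MemLp w (2 * ((q : ℝ≥0∞) + 1)) μ)
    (hz : MemLp z (2 * ((q : ℝ≥0∞) + 1)) μ) (hv : MemLp v (2 * ((q : ℝ≥0∞) + 1)) μ) :
    Integrable (fun x => u x ^ i * w x ^ j * z x * v x) μ := by
  refine ⟨(((hu.1.pow i).mul (hw.1.pow j)).mul hz.1).mul hv.1, ?_⟩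
  have e : ∀ {h : X → ℝ}, MemLp h (2 * ((q : ℝ≥0∞) + 1)) μ →
      eLpNorm h (2 * ((q : ℝ≥0∞) + 1)) μ
        ≤ ENNReal.ofReal (eLpNorm h (2 * ((q : ℝ≥0∞) + 1)) μ).toReal :=
    fun h => (ENNReal.ofReal_toReal h.2.ne).ge
  exact (lintegral_enorm_pow_mul_le hij hu.1 hw.1 hz.1 hv.1 ENNReal.toReal_nonneg
    ENNReal.toReal_nonneg ENNReal.toReal_nonneg (e hu) (e hw) (e hz) (e hv)).trans_lt
    ENNReal.ofReal_lt_top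

theorem abs_integral_pow_mul_le {i j : ℕ} (hij : i + j = 2 * q) {u w z v : X → ℝ}
    (hu : AEStronglyMeasurable u μ) (hw : AEStronglyMeasurable w μ)
    (hz : AEStronglyMeasurable z μ) (hv : AEStronglyMeasurable v μ) {A B C D : ℝ}
    (hA0 : 0 ≤ A) (hB0 : 0 ≤ B) (hC0 : 0 ≤ C) (hD0 : 0 ≤ D)
    (hA : eLpNorm u (2 * ((q : ℝ≥0∞) + 1)) μ ≤ ENNReal.ofReal A)
    (hB : eLpNorm w (2 * ((q : ℝ≥0∞) + 1)) μ ≤ ENNReal.ofReal B)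
    (hC : eLpNorm z (2 * ((q : ℝ≥0∞) + 1)) μ ≤ ENNReal.ofReal C)
    (hD : eLpNorm v (2 * ((q : ℝ≥0∞) + 1)) μ ≤ ENNReal.ofReal D) :
    |∫ x, u x ^ i * w x ^ j * z x * v x ∂μ| ≤ A ^ i * B ^ j * C * D := by
  have h := (enorm_integral_le_lintegral_enorm (μ := μ)
    (fun x => u x ^ i * w x ^ j * z x * v x)).trans
    (lintegral_enorm_pow_mul_le hij hu hw hz hv hA0 hB0 hC0 hA hB hC hD)
  rw [← Real.norm_eq_abs]
  rw [← ofReal_norm] at h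
  exact (ENNReal.ofReal_le_ofReal_iff (by positivity)).1 h

theorem integrable_pow_succ_mul {u v : X → ℝ}
    (hu : MemLp u (2 * ((q : ℝ≥0∞) + 1)) μ) (hv : MemLp v (2 * ((q : ℝ≥0∞) + 1)) μ) :
    Integrable (fun x => u x ^ (2 * q + 1) * v x) μ := by
  refine (integrable_pow_mul (i := 2 * q) (j := 0) (by simp) hu hu hu hv).congr ?_
  filter_upwards with x
  ring

theorem abs_integral_pow_succ_mul_le {u v : X → ℝ}
    (hu : AEStronglyMeasurable u μ) (hv : AEStronglyMeasurable v μ) {A D : ℝ}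
    (hA0 : 0 ≤ A) (hD0 : 0 ≤ D)
    (hA : eLpNorm u (2 * ((q : ℝ≥0∞) + 1)) μ ≤ ENNReal.ofReal A)
    (hD : eLpNorm v (2 * ((q : ℝ≥0∞) + 1)) μ ≤ ENNReal.ofReal D) :
    |∫ x, u x ^ (2 * q + 1) * v x ∂μ| ≤ A ^ (2 * q) * A * D := by
  have h := abs_integral_pow_mul_le (i := 2 * q) (j := 0) (by simp) hu hu hu hv hA0 hA0 hA0 hD0
    hA hA hA hD
  simpa [pow_succ] using h

/-- Factor u^(2q+1) - w^(2q+1) as (u - w) times the sum of the 2q+1 products u^i w^(2q-i), and apply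
Hölder to each; this is the origin of the factor 2q+1. -/
theorem abs_integral_pow_succ_sub_mul_le {u w v : X → ℝ}
    (hu : MemLp u (2 * ((q : ℝ≥0∞) + 1)) μ) (hw : MemLp w (2 * ((q : ℝ≥0∞) + 1)) μ)
    (hv : MemLp v (2 * ((q : ℝ≥0∞) + 1)) μ) {R C D : ℝ}
    (hR0 : 0 ≤ R) (hC0 : 0 ≤ C) (hD0 : 0 ≤ D)
    (hu' : eLpNorm u (2 * ((q : ℝ≥0∞) + 1)) μ ≤ ENNReal.ofReal R)
    (hw' : eLpNorm w (2 * ((q : ℝ≥0∞) + 1)) μ ≤ ENNReal.ofReal R)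
    (hC : eLpNorm (u - w) (2 * ((q : ℝ≥0∞) + 1)) μ ≤ ENNReal.ofReal C)
    (hD : eLpNorm v (2 * ((q : ℝ≥0∞) + 1)) μ ≤ ENNReal.ofReal D) :
    |(∫ x, u x ^ (2 * q + 1) * v x ∂μ) - ∫ x, w x ^ (2 * q + 1) * v x ∂μ|
      ≤ (2 * q + 1) * R ^ (2 * q) * C * D := by
  rw [← integral_sub (integrable_pow_succ_mul hu hv) (integrable_pow_succ_mul hw hv)]
  have e : (fun x => u x ^ (2 * q + 1) * v x - w x ^ (2 * q + 1) * v x) = fun x =>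
      ∑ i ∈ Finset.range (2 * q + 1), u x ^ i * w x ^ (2 * q - i) * (u - w) x * v x := by
    ext x
    rw [← sub_mul, ← (Commute.all (u x) (w x)).geom_sum₂_mul, Finset.sum_mul, Finset.sum_mul]
    rfl
  have hij : ∀ i ∈ Finset.range (2 * q + 1), i + (2 * q - i) = 2 * q := fun i hi => by
    have := Finset.mem_range.1 hi
    omega
  rw [e, integral_finsetSum _ fun i hi => integrable_pow_mul (hij i hi) hu hw (hu.sub hw) hv]
  refine (Finset.abs_sum_le_sum_abs _ _).trans ?_
  refine (Finset.sum_le_sum (g := fun _ => R ^ (2 * q) * C * D) fun i hi => ?_).trans_eq ?_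
  · refine (abs_integral_pow_mul_le (hij i hi) hu.1 hw.1 (hu.1.sub hw.1) hv.1 hR0 hR0 hC0 hD0
      hu' hw' hC hD).trans_eq ?_
    rw [← pow_add, hij i hi]
  · simp
    ring

theorem integral_pow_succ_mul_sub_le {u w : X → ℝ}
    (hu : MemLp u (2 * ((q : ℝ≥0∞) + 1)) μ) (hw : MemLp w (2 * ((q : ℝ≥0∞) + 1)) μ) :
    ∫ x, w x ^ (2 * q + 1) * (u - w) x ∂μ ≤ ∫ x, u x ^ (2 * q + 1) * (u - w) x ∂μ := by
  refine integral_mono (integrable_pow_succ_mul hw (hu.sub hw))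
    (integrable_pow_succ_mul hu (hu.sub hw)) fun x => ?_
  have hm : Monotone fun y : ℝ => y ^ (2 * q + 1) := (odd_two_mul_add_one q).strictMono_pow.monotone
  simp only [Pi.sub_apply]
  rcases le_total (u x) (w x) with h | h
  · nlinarith [hm h]
  · nlinarith [hm h]

/-- The exponent `2(q+1)/(2q+1)` is conjugate to `2(q+1)`. -/
theorem holderConjugate_sobolevExponent (q : ℕ) :
    ENNReal.HolderConjugate (ENNReal.ofReal (2 * ((q : ℝ) + 1) / (2 * q + 1)))
      (2 * ((q : ℝ≥0∞) + 1)) := by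
  have h : (2 * ((q : ℝ≥0∞) + 1)) = ENNReal.ofReal (2 * ((q : ℝ) + 1)) := by
    rw [← toReal_sobolevExponent, ENNReal.ofReal_toReal]
    exact ENNReal.mul_ne_top (by simp) (by simp)
  rw [h]
  refine ⟨?_⟩
  rw [← ENNReal.ofReal_inv_of_pos (by positivity), ← ENNReal.ofReal_inv_of_pos (by positivity),
    ← ENNReal.ofReal_add (by positivity) (by positivity), inv_one, ← ENNReal.ofReal_one]
  congr 1
  field_simp
  ring

theorem dualExponent_le_two (q : ℕ) :
    ENNReal.ofReal (2 * ((q : ℝ) + 1) / (2 * q + 1)) ≤ 2 := by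
  rw [show (2 : ℝ≥0∞) = ENNReal.ofReal 2 by simp]
  refine ENNReal.ofReal_le_ofReal ?_
  rw [div_le_iff₀ (by positivity)]
  have : (0 : ℝ) ≤ q := by positivity
  linarith

theorem abs_integral_mul_le_dual {h v : X → ℝ}
    (hh : MemLp h (ENNReal.ofReal (2 * ((q : ℝ) + 1) / (2 * q + 1))) μ)
    (hv : AEStronglyMeasurable v μ) {D : ℝ} (hD0 : 0 ≤ D)
    (hD : eLpNorm v (2 * ((q : ℝ≥0∞) + 1)) μ ≤ ENNReal.ofReal D) :
    |∫ x, h x * v x ∂μ|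
      ≤ (eLpNorm h (ENNReal.ofReal (2 * ((q : ℝ) + 1) / (2 * q + 1))) μ).toReal * D := by
  have := holderConjugate_sobolevExponent q
  have h1 := eLpNorm_smul_le_mul_eLpNorm (r := 1)
    (p := ENNReal.ofReal (2 * ((q : ℝ) + 1) / (2 * q + 1))) (q := 2 * ((q : ℝ≥0∞) + 1)) hv hh.1
  rw [eLpNorm_one_eq_lintegral_enorm] at h1
  have h2 := (enorm_integral_le_lintegral_enorm (μ := μ) (h • v)).trans
    (h1.trans (mul_le_mul_right hD _))
  rw [← ENNReal.ofReal_toReal hh.2.ne, ← ENNReal.ofReal_mul ENNReal.toReal_nonneg,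
    ← ofReal_norm] at h2
  exact (ENNReal.ofReal_le_ofReal_iff (by positivity)).1 h2

end Holder

/-! ### One step of the iteration -/

/-- If `b` and `m ≥ 0` are the values at `v` and `e` of a linear functional of norm at most `M`,
then `x ↦ s ⟪e, x⟫ - t (functional)` is bounded by `√(s² ‖e‖² + t² M²)`. -/
theorem abs_inner_sub_le_of_dominated {H : Type*} [NormedAddCommGroup H] [InnerProductSpace ℝ H]
    {e v : H} {b m M s t : ℝ} (hs : 0 ≤ s) (ht : 0 ≤ t) (hM : 0 ≤ M) (hm : 0 ≤ m)
    (h : ∀ x y : ℝ, |x * b + y * m| ≤ M * ‖x • v + y • e‖) :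
    |s * inner ℝ e v - t * b| ≤ √(s ^ 2 * ‖e‖ ^ 2 + t ^ 2 * M ^ 2) * ‖v‖ := by
  set E := ‖e‖ ^ 2 with hE
  set F := ‖v‖ ^ 2 with hF
  set r : ℝ := inner ℝ e v with hr
  have hE0 : 0 ≤ E := by positivity
  have hF0 : 0 ≤ F := by positivity
  have hsq : ∀ x y : ℝ, (x * b + y * m) ^ 2 ≤ M ^ 2 * (x ^ 2 * F + 2 * x * y * r + y ^ 2 * E) := by
    intro x y
    have h1 : (x * b + y * m) ^ 2 ≤ (M * ‖x • v + y • e‖) ^ 2 :=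
      sq_le_sq' (by linarith [neg_abs_le (x * b + y * m), h x y]) ((le_abs_self _).trans (h x y))
    refine h1.trans_eq ?_
    rw [mul_pow, norm_add_sq_real, norm_smul, norm_smul, inner_smul_left, inner_smul_right,
      real_inner_comm, mul_pow, mul_pow, Real.norm_eq_abs, Real.norm_eq_abs, sq_abs, sq_abs]
    simp only [conj_trivial]
    ring
  have hrEF : r ^ 2 ≤ E * F := by
    have := real_inner_mul_inner_self_le e v
    rw [real_inner_self_eq_norm_sq, real_inner_self_eq_norm_sq] at this
    nlinarith
  have hb : b ^ 2 ≤ M ^ 2 * F := by simpa using hsq 1 0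
  have hmE : m ^ 2 ≤ M ^ 2 * E := by simpa using hsq 0 1
  -- the determinant of the nonnegative quadratic form `M² ‖x v + y e‖² - (x b + y m)²`
  have hdet : (M ^ 2 * r - b * m) ^ 2 ≤ (M ^ 2 * F - b ^ 2) * (M ^ 2 * E - m ^ 2) := by
    have hq : ∀ x : ℝ, 0 ≤ (M ^ 2 * F - b ^ 2) * (x * x) + 2 * (M ^ 2 * r - b * m) * x
        + (M ^ 2 * E - m ^ 2) := fun x => by nlinarith [hsq x 1]
    have := discrim_le_zero hq
    unfold discrim at this
    nlinarith
  have hmain : (s * r - t * b) ^ 2 ≤ (s ^ 2 * E + t ^ 2 * M ^ 2) * F := by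
    -- If r and b do not have opposite signs, the cross term -2st·rb is nonpositive and can be
    -- dropped. Otherwise m ≥ 0 and r·b < 0 turn the determinant bound into M²r² + b²E ≤ M²FE.
    rcases le_or_gt 0 (r * b) with hrb | hrb
    · have h1 : 0 ≤ s * t * (r * b) := by positivity
      have h2 : s ^ 2 * r ^ 2 ≤ s ^ 2 * (E * F) := by gcongr
      have h3 : t ^ 2 * b ^ 2 ≤ t ^ 2 * (M ^ 2 * F) := by gcongr
      nlinarith
    · have hM2 : 0 < M ^ 2 := by
        rcases hM.eq_or_lt with h0 | h0
        · exfalso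
          have : b ^ 2 ≤ 0 := by simpa [← h0] using hb
          have : b = 0 := by nlinarith
          simp [this] at hrb
        · positivity
      have h1 : M ^ 2 * (M ^ 2 * r ^ 2) ≤ M ^ 2 * ((M ^ 2 * F - b ^ 2) * E) := by
        have h2 : (M ^ 2 * r) ^ 2 ≤ (M ^ 2 * r - b * m) ^ 2 := by
          have : 0 ≤ M ^ 2 * m * (-(r * b)) :=
            mul_nonneg (mul_nonneg hM2.le hm) (by linarith)
          nlinarith [sq_nonneg (b * m)]
        have h3 : (M ^ 2 * F - b ^ 2) * (M ^ 2 * E - m ^ 2)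
            ≤ (M ^ 2 * F - b ^ 2) * (M ^ 2 * E) :=
          mul_le_mul_of_nonneg_left (by nlinarith [sq_nonneg m]) (by linarith)
        nlinarith
      have h2 : M ^ 2 * r ^ 2 + b ^ 2 * E ≤ M ^ 2 * F * E := by
        have := le_of_mul_le_mul_left h1 hM2
        linarith
      have hEpos : 0 < E := by
        rcases hE0.eq_or_lt with h0 | h0
        · exfalso
          have : r ^ 2 ≤ 0 := by simpa [← h0] using hrEF
          have : r = 0 := by nlinarith
          simp [this] at hrb
        · exact h0
      have h3 : (M ^ 2 * E) * (s * r - t * b) ^ 2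
          ≤ (M ^ 2 * E) * ((s ^ 2 * E + t ^ 2 * M ^ 2) * F) := by
        -- Cauchy–Schwarz for the pairs (s√E, tM) and (r/√E, -b/M), with denominators cleared.
        have h4 : (M ^ 2 * E) * (s * r - t * b) ^ 2
            ≤ (s ^ 2 * E + t ^ 2 * M ^ 2) * (M ^ 2 * r ^ 2 + b ^ 2 * E) := by
          nlinarith [sq_nonneg (s * E * b + t * M ^ 2 * r)]
        refine h4.trans ?_
        have := mul_le_mul_of_nonneg_left h2
          (show 0 ≤ s ^ 2 * E + t ^ 2 * M ^ 2 by positivity)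
        linarith
      exact le_of_mul_le_mul_left h3 (by positivity)
  rw [← Real.sqrt_sq (norm_nonneg v), ← Real.sqrt_mul (by positivity)]
  exact Real.abs_le_sqrt hmain

/-! ### Bounds for the forms on H¹_D and the one-step estimate. -/

variable {Ω Γ : Set Plane} {q : ℕ} {lam Cq α : ℝ}

theorem aForm_eq_inner (v w : L2Pair Ω) : aForm v w = inner ℝ v.2 w.2 := rfl

theorem gradNorm_nonneg (v : L2Pair Ω) : 0 ≤ gradNorm v := norm_nonneg _

theorem IsSobolevConstant.memLp (hCq : IsSobolevConstant Ω Γ q Cq) {v : L2Pair Ω}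
    (hv : v ∈ H1D Ω Γ) :
    MemLp (v.1 : Plane → ℝ) (2 * ((q : ℝ≥0∞) + 1)) (volume.restrict Ω) :=
  ⟨(Lp.memLp v.1).1, (hCq.2 v hv).trans_lt ENNReal.ofReal_lt_top⟩

theorem IsSobolevConstant.eLpNorm_le (hCq : IsSobolevConstant Ω Γ q Cq) {v : L2Pair Ω}
    (hv : v ∈ H1D Ω Γ) {R : ℝ} (hR : gradNorm v ≤ R) :
    eLpNorm (v.1 : Plane → ℝ) (2 * ((q : ℝ≥0∞) + 1)) (volume.restrict Ω)
      ≤ ENNReal.ofReal (Cq * R) :=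
  (hCq.2 v hv).trans (ENNReal.ofReal_le_ofReal (mul_le_mul_of_nonneg_left hR hCq.1.le))

theorem bForm_sub_right (q : ℕ) (u w v : L2Pair Ω) :
    bForm q u (w - v) = ∫ x in Ω, (u.1 x) ^ (2 * q + 1) * ((w.1 : Plane → ℝ) - (v.1 : Plane → ℝ)) x := by
  refine integral_congr_ae ?_
  filter_upwards [Lp.coeFn_sub w.1 v.1] with x hx
  have hx' : (w - v).1 x = ((w.1 : Plane → ℝ) - (v.1 : Plane → ℝ)) x := hx
  simp only [hx']

theorem bForm_add_smul (hCq : IsSobolevConstant Ω Γ q Cq) {u v w : L2Pair Ω}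
    (hu : u ∈ H1D Ω Γ) (hv : v ∈ H1D Ω Γ) (hw : w ∈ H1D Ω Γ) (x y : ℝ) :
    bForm q u (x • v + y • w) = x * bForm q u v + y * bForm q u w := by
  have h1 : bForm q u (x • v + y • w)
      = ∫ z in Ω, (x * ((u.1 z) ^ (2 * q + 1) * v.1 z) + y * ((u.1 z) ^ (2 * q + 1) * w.1 z)) := by
    refine integral_congr_ae ?_
    filter_upwards [Lp.coeFn_add (x • v.1) (y • w.1), Lp.coeFn_smul x v.1, Lp.coeFn_smul y w.1]
      with z h1 h2 h3
    have h1' : (x • v + y • w).1 z = x * v.1 z + y * w.1 z := by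
      refine h1.trans ?_
      rw [Pi.add_apply, h2, h3]
      rfl
    simp only [h1']
    ring
  rw [h1, integral_add ((integrable_pow_succ_mul (hCq.memLp hu) (hCq.memLp hv)).const_mul x)
    ((integrable_pow_succ_mul (hCq.memLp hu) (hCq.memLp hw)).const_mul y),
    integral_const_mul, integral_const_mul]
  rfl

theorem abs_bForm_le (hCq : IsSobolevConstant Ω Γ q Cq) {u v : L2Pair Ω}
    (hu : u ∈ H1D Ω Γ) (hv : v ∈ H1D Ω Γ) {R : ℝ} (hR : gradNorm u ≤ R) :
    |bForm q u v| ≤ Cq ^ (2 * (q + 1)) * R ^ (2 * q) * gradNorm u * gradNorm v := by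
  have hC := hCq.1.le
  have h0 := gradNorm_nonneg u
  have h1 := gradNorm_nonneg v
  have h := abs_integral_pow_succ_mul_le (hCq.memLp hu).1 (hCq.memLp hv).1
    (mul_nonneg hC h0) (mul_nonneg hC h1) (hCq.2 u hu) (hCq.2 v hv)
  refine (h.trans_eq ?_).trans (b := Cq ^ (2 * (q + 1)) * gradNorm u ^ (2 * q) * gradNorm u
    * gradNorm v) ?_
  · ring
  · gcongr

theorem abs_bForm_sub_le (hCq : IsSobolevConstant Ω Γ q Cq) {u w v : L2Pair Ω}
    (hu : u ∈ H1D Ω Γ) (hw : w ∈ H1D Ω Γ) (hv : v ∈ H1D Ω Γ) {R : ℝ}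
    (hR : gradNorm u ≤ R) (hR' : gradNorm w ≤ R) :
    |bForm q u v - bForm q w v|
      ≤ (2 * q + 1) * Cq ^ (2 * (q + 1)) * R ^ (2 * q) * gradNorm (u - w) * gradNorm v := by
  have hC := hCq.1.le
  have hR0 : 0 ≤ R := (gradNorm_nonneg u).trans hR
  have hd : eLpNorm ((u.1 : Plane → ℝ) - (w.1 : Plane → ℝ)) (2 * ((q : ℝ≥0∞) + 1)) (volume.restrict Ω)
      ≤ ENNReal.ofReal (Cq * gradNorm (u - w)) := by
    refine (eLpNorm_congr_ae (Lp.coeFn_sub u.1 w.1)).symm.trans_le ?_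
    exact hCq.2 (u - w) ((H1D Ω Γ).sub_mem hu hw)
  refine (abs_integral_pow_succ_sub_mul_le (hCq.memLp hu) (hCq.memLp hw) (hCq.memLp hv)
    (mul_nonneg hC hR0) (mul_nonneg hC (gradNorm_nonneg _)) (mul_nonneg hC (gradNorm_nonneg v))
    (hCq.eLpNorm_le hu hR) (hCq.eLpNorm_le hw hR') hd (hCq.2 v hv)).trans_eq ?_
  ring

theorem bForm_monotone (hCq : IsSobolevConstant Ω Γ q Cq) {u w : L2Pair Ω}
    (hu : u ∈ H1D Ω Γ) (hw : w ∈ H1D Ω Γ) :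
    bForm q w (u - w) ≤ bForm q u (u - w) := by
  rw [bForm_sub_right, bForm_sub_right]
  exact integral_pow_succ_mul_sub_le (hCq.memLp hu) (hCq.memLp hw)

theorem abs_exactLoad_le (hCq : IsSobolevConstant Ω Γ q Cq) {h : Plane → ℝ}
    (hh : MemLp h (ENNReal.ofReal (2 * ((q : ℝ) + 1) / (2 * q + 1))) (volume.restrict Ω))
    {v : L2Pair Ω} (hv : v ∈ H1D Ω Γ) :
    |exactLoad h v| ≤ rho Ω q Cq h * gradNorm v := by
  refine (abs_integral_mul_le_dual hh (hCq.memLp hv).1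
    (mul_nonneg hCq.1.le (gradNorm_nonneg v)) (hCq.2 v hv)).trans_eq ?_
  unfold rho
  ring

/-- Subtract the two step equations, both tested with u' - w'. Keeping M free allows two uses: M a
Lipschitz constant for comparing two sequences, and w = w' = 0 with a smaller M for bounding one
sequence. -/
theorem gradNorm_step_sub_le (hCq : IsSobolevConstant Ω Γ q Cq) (hlam : 0 ≤ lam)
    (hα0 : 0 ≤ α) (hα1 : α ≤ 1) {u w u' w' : L2Pair Ω}
    (hu : u ∈ H1D Ω Γ) (hw : w ∈ H1D Ω Γ) (hu' : u' ∈ H1D Ω Γ) (hw' : w' ∈ H1D Ω Γ)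
    {ℓ ℓ' M δ : ℝ} (hM0 : 0 ≤ M) (hδ : 0 ≤ δ)
    (hM : ∀ v ∈ H1D Ω Γ,
      lam * |bForm q u v - bForm q w v| ≤ M * gradNorm (u - w) * gradNorm v)
    (hℓ : |ℓ - ℓ'| ≤ δ * gradNorm (u' - w'))
    (h1 : aForm u' (u' - w')
      = (1 - α) * aForm u (u' - w') + α * (ℓ - lam * bForm q u (u' - w')))
    (h2 : aForm w' (u' - w')
      = (1 - α) * aForm w (u' - w') + α * (ℓ' - lam * bForm q w (u' - w'))) :
    gradNorm (u' - w') ≤ √((1 - α) ^ 2 + α ^ 2 * M ^ 2) * gradNorm (u - w) + α * δ := by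
  set e := u - w with he
  set v := u' - w' with hv
  have heW : e ∈ H1D Ω Γ := (H1D Ω Γ).sub_mem hu hw
  have hvW : v ∈ H1D Ω Γ := (H1D Ω Γ).sub_mem hu' hw'
  -- The functional is λ(b(u;·) - b(w;·)); its value at e is nonnegative by monotonicity of b, and
  -- its norm is at most M‖∇e‖.
  have key := abs_inner_sub_le_of_dominated (e := e.2) (v := v.2)
    (b := lam * (bForm q u v - bForm q w v)) (m := lam * (bForm q u e - bForm q w e))
    (M := M * gradNorm e) (s := 1 - α) (t := α) (by linarith) hα0
    (mul_nonneg hM0 (gradNorm_nonneg e))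
    (mul_nonneg hlam (sub_nonneg.2 (bForm_monotone hCq hu hw))) (by
      intro x y
      have h := hM (x • v + y • e)
        ((H1D Ω Γ).add_mem ((H1D Ω Γ).smul_mem x hvW) ((H1D Ω Γ).smul_mem y heW))
      rw [bForm_add_smul hCq hu hvW heW, bForm_add_smul hCq hw hvW heW] at h
      refine le_trans (le_of_eq ?_) h
      rw [← abs_of_nonneg hlam, ← abs_mul, abs_of_nonneg hlam]
      congr 1
      ring)
  have hsq : √((1 - α) ^ 2 * ‖e.2‖ ^ 2 + α ^ 2 * (M * gradNorm e) ^ 2)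
      = √((1 - α) ^ 2 + α ^ 2 * M ^ 2) * gradNorm e := by
    rw [← Real.sqrt_sq (gradNorm_nonneg e), ← Real.sqrt_mul (by positivity),
      Real.sqrt_sq (gradNorm_nonneg e)]
    congr 1
    simp only [gradNorm]
    ring
  rw [hsq] at key
  have hvv : gradNorm v ^ 2 = aForm u' v - aForm w' v := by
    rw [aForm_eq_inner, aForm_eq_inner, ← inner_sub_left, gradNorm, ← real_inner_self_eq_norm_sq]
    rfl
  have hev : inner ℝ e.2 v.2 = aForm u v - aForm w v := by
    rw [aForm_eq_inner, aForm_eq_inner, ← inner_sub_left]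
    rfl
  have h3 : gradNorm v * gradNorm v
      ≤ (√((1 - α) ^ 2 + α ^ 2 * M ^ 2) * gradNorm e + α * δ) * gradNorm v := by
    have h4 : gradNorm v ^ 2 = ((1 - α) * inner ℝ e.2 v.2
        - α * (lam * (bForm q u v - bForm q w v))) + α * (ℓ - ℓ') := by
      rw [hvv, hev, h1, h2]
      ring
    have h5 := (le_abs_self _).trans key
    have h6 : α * (ℓ - ℓ') ≤ α * (δ * gradNorm v) :=
      mul_le_mul_of_nonneg_left ((le_abs_self _).trans hℓ) hα0
    have h7 : √((1 - α) ^ 2 + α ^ 2 * M ^ 2) * gradNorm e * ‖v.2‖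
      = √((1 - α) ^ 2 + α ^ 2 * M ^ 2) * gradNorm e * gradNorm v := rfl
    nlinarith
  rcases (gradNorm_nonneg v).eq_or_lt with h0 | h0
  · rw [← h0]
    have := mul_nonneg (Real.sqrt_nonneg ((1 - α) ^ 2 + α ^ 2 * M ^ 2)) (gradNorm_nonneg e)
    have := mul_nonneg hα0 hδ
    linarith
  · exact le_of_mul_le_mul_right h3 h0

end HpILG
end

noncomputable section
namespace HpILG

open MeasureTheory Set
open scoped ContDiff ENNReal

/-! ### Integration over a triangulation -/

theorem measurableSet_triangle (T : Finset Plane) : MeasurableSet (triangle T) :=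
  (T.finite_toSet.isCompact_convexHull ℝ).isClosed.measurableSet

/-- The convex hull of at most two points of the plane is a null set. -/
theorem volume_convexHull_eq_zero {S : Finset Plane} (hS : S.card ≤ 2) :
    volume (convexHull ℝ (S : Set Plane)) = 0 := by
  refine measure_mono_null (convexHull_subset_affineSpan (S : Set Plane))
    (Measure.addHaar_affineSubspace volume _ fun htop => ?_)
  rcases S.eq_empty_or_nonempty with rfl | hne
  · simp at htop
  · have h1 : Module.finrank ℝ (vectorSpan ℝ (S : Set Plane)) ≤ 1 := by
      have := finrank_vectorSpan_image_finset_le ℝ (id : Plane → Plane) S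
        (n := S.card - 1) (by have := hne.card_pos; omega)
      rw [Finset.image_id] at this
      omega
    rw [← direction_affineSpan, htop, AffineSubspace.direction_top, finrank_top,
      finrank_euclideanSpace_fin] at h1
    omega

variable {m : ℕ} [NeZero m] {Ω Γ : Set Plane} {c : Fin m → Plane}

theorem IsPolygon.volume_frontier (hΩ : IsPolygon Ω c) : volume (frontier Ω) = 0 := by
  classical
  rw [hΩ.frontier_eq]
  refine measure_iUnion_null fun i => ?_
  have h := volume_convexHull_eq_zero (S := {c i, c (i + 1)}) Finset.card_le_two
  rwa [Finset.coe_pair, convexHull_pair] at h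

theorem IsRegularPartition.subset_iUnion {𝒯 : Finset (Finset Plane)}
    (h𝒯 : IsRegularPartition Ω 𝒯) : ⋃ T : 𝒯, Ω ∩ triangle T.1 = Ω := by
  rw [← inter_iUnion, inter_eq_left]
  refine (subset_closure.trans h𝒯.cover.ge).trans (iUnion₂_subset fun T hT => ?_)
  exact Set.subset_iUnion (fun T : 𝒯 => triangle T.1) ⟨T, hT⟩

/-- Distinct three-point vertex sets share at most two points, so the triangles meet in a point, a
segment or nothing. -/
theorem IsRegularPartition.aedisjoint {𝒯 : Finset (Finset Plane)}
    (h𝒯 : IsRegularPartition Ω 𝒯) {T T' : Finset Plane} (hT : T ∈ 𝒯) (hT' : T' ∈ 𝒯)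
    (hne : T ≠ T') : AEDisjoint volume (triangle T) (triangle T') := by
  classical
  unfold AEDisjoint
  rw [h𝒯.inter_eq T hT T' hT', ← Finset.coe_inter]
  refine volume_convexHull_eq_zero ?_
  by_contra! h
  have h1 : T ∩ T' = T := Finset.eq_of_subset_of_card_le Finset.inter_subset_left
    (by rw [h𝒯.card_eq T hT]; omega)
  have h2 : T ∩ T' = T' := Finset.eq_of_subset_of_card_le Finset.inter_subset_right
    (by rw [h𝒯.card_eq T' hT']; omega)
  exact hne (h1.symm.trans h2)

theorem IsRegularPartition.setIntegral_eq_sum {𝒯 : Finset (Finset Plane)}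
    (h𝒯 : IsRegularPartition Ω 𝒯) (hΩ : IsOpen Ω) {F : Plane → ℝ} (hF : IntegrableOn F Ω) :
    ∫ x in Ω, F x = ∑ T ∈ 𝒯, ∫ x in Ω ∩ triangle T, F x := by
  have h := integral_iUnion_ae (μ := volume) (f := F) (s := fun T : 𝒯 => Ω ∩ triangle T.1)
    (fun T => (hΩ.measurableSet.inter (measurableSet_triangle T.1)).nullMeasurableSet)
    (fun T T' hne => (h𝒯.aedisjoint T.2 T'.2 (Subtype.coe_ne_coe.2 hne)).mono
      inter_subset_right inter_subset_right)
    (by rwa [h𝒯.subset_iUnion])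
  rw [h𝒯.subset_iUnion, tsum_fintype] at h
  rw [h]
  exact Finset.sum_coe_sort 𝒯 fun T => ∫ x in Ω ∩ triangle T, F x

/-- Mesh triangles lie in the closure of Ω, so only boundary points are lost, and the boundary is a
null set. -/
theorem IsPolygon.inter_triangle_ae_eq (hΩ : IsPolygon Ω c) {𝒯 : Finset (Finset Plane)}
    (h𝒯 : IsRegularPartition Ω 𝒯) {T : Finset Plane} (hT : T ∈ 𝒯) :
    (Ω ∩ triangle T : Set Plane) =ᵐ[volume] triangle T := by
  refine inter_subset_right.eventuallyLE.antisymm ?_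
  rw [ae_le_set]
  refine measure_mono_null ?_ hΩ.volume_frontier
  rintro x ⟨hx, hx'⟩
  rw [hΩ.isOpen.frontier_eq]
  refine ⟨?_, fun h => hx' ⟨h, hx⟩⟩
  rw [← h𝒯.cover]
  exact mem_biUnion hT hx

/-! ### Elementwise polynomials and exact quadrature. -/

theorem continuous_polyEval (P : MvPolynomial (Fin 2) ℝ) : Continuous (polyEval P) :=
  (MvPolynomial.continuous_eval P).comp (continuous_pi fun i => by fun_prop)

theorem isElementPoly_elementPoly {T : Finset Plane} {d : ℕ} {u : Plane → ℝ}
    (h : ∃ P, IsElementPoly Ω T d u P) : IsElementPoly Ω T d u (elementPoly Ω T d u) := by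
  unfold elementPoly
  rw [dif_pos h]
  exact h.choose_spec

theorem IsRegularPartition.aestronglyMeasurable {𝒯 : Finset (Finset Plane)}
    (h𝒯 : IsRegularPartition Ω 𝒯) {d : ℕ} {g : Plane → ℝ}
    (hg : ∀ T ∈ 𝒯, ∃ P, IsElementPoly Ω T d g P) :
    AEStronglyMeasurable g (volume.restrict Ω) := by
  rw [← h𝒯.subset_iUnion, aestronglyMeasurable_iUnion_iff]
  rintro ⟨T, hT⟩
  obtain ⟨P, -, hP⟩ := hg T hT
  refine (continuous_polyEval P).aestronglyMeasurable.congr ?_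
  rw [inter_comm, ← Measure.restrict_restrict (measurableSet_triangle T)]
  filter_upwards [ae_restrict_of_ae hP, ae_restrict_mem (measurableSet_triangle T)] with x h1 h2
  exact (h1 h2).symm

/-- Exact quadrature of the elementwise polynomial source gives its exact load. -/
theorem quadratureLoad_eq_exactLoad (hΩ : IsPolygon Ω c) {𝒯 : Finset (Finset Plane)}
    (h𝒯 : IsRegularPartition Ω 𝒯) {d p : ℕ} {g : Plane → ℝ}
    (hg : ∀ T ∈ 𝒯, ∃ P, IsElementPoly Ω T d g P) (hg2 : MemLp g 2 (volume.restrict Ω))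
    {Q : (T : Finset Plane) → QuadratureRule T} (hQ : ∀ T ∈ 𝒯, (Q T).IsExact (d + p))
    {v : L2Pair Ω} (hv : v ∈ hpSpace Ω Γ 𝒯 p) :
    quadratureLoad 𝒯 Q d p g v = exactLoad g v := by
  unfold quadratureLoad exactLoad
  rw [h𝒯.setIntegral_eq_sum (F := fun x => g x * v.1 x) hΩ.isOpen (hg2.integrable_mul (q := 2) (Lp.memLp v.1))]
  refine Finset.sum_congr rfl fun T hT => ?_
  obtain ⟨hdeg, hgP⟩ := isElementPoly_elementPoly (hg T hT)
  obtain ⟨hdeg', hvP⟩ := isElementPoly_elementPoly (hv.2 T hT)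
  have hmul : (fun x => polyEval (elementPoly Ω T d g) x * polyEval (elementPoly Ω T p v.1) x)
      = polyEval (elementPoly Ω T d g * elementPoly Ω T p v.1) := by
    ext x
    simp [polyEval]
  -- The product has degree at most d + p, within the exactness of the rule. The rule integrates
  -- over T, the load over Ω ∩ T; these differ by a null set.
  rw [hmul, hQ T hT _ ((MvPolynomial.totalDegree_mul _ _).trans (add_le_add hdeg hdeg')),
    ← setIntegral_congr_set (hΩ.inter_triangle_ae_eq h𝒯 hT), ← hmul, inter_comm,
    ← Measure.restrict_restrict (measurableSet_triangle T)]
  refine integral_congr_ae ?_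
  filter_upwards [ae_restrict_of_ae hgP, ae_restrict_of_ae hvP,
    ae_restrict_mem (measurableSet_triangle T)] with x h1 h2 h3
  rw [h1 h3, h2 h3]

end HpILG
end

noncomputable section
namespace HpILG

open MeasureTheory Set
open scoped ContDiff ENNReal

/-! ### Uniform stability of the iteration -/

variable {Ω Γ : Set Plane} {q : ℕ} {lam Cq α : ℝ} {W : Submodule ℝ (L2Pair Ω)}

theorem IsILGIteration.gradNorm_sub_succ_le (hCq : IsSobolevConstant Ω Γ q Cq) (hlam : 0 ≤ lam)
    (hα0 : 0 ≤ α) (hα1 : α ≤ 1) (hW : W ≤ H1D Ω Γ) {ℓ ℓ' : L2Pair Ω → ℝ}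
    {U V : ℕ → L2Pair Ω} (hU : IsILGIteration W q lam α ℓ U)
    (hV : IsILGIteration W q lam α ℓ' V) {δ R : ℝ} (hδ : 0 ≤ δ)
    (hℓ : ∀ v ∈ W, |ℓ v - ℓ' v| ≤ δ * gradNorm v) {n : ℕ}
    (hUR : gradNorm (U n) ≤ R) (hVR : gradNorm (V n) ≤ R) :
    gradNorm (U (n + 1) - V (n + 1))
      ≤ √((1 - α) ^ 2 + α ^ 2 * (lam * (2 * q + 1) * Cq ^ (2 * (q + 1)) * R ^ (2 * q)) ^ 2)
        * gradNorm (U n - V n) + α * δ := by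
  have hC := hCq.1
  have hR0 : 0 ≤ R := (gradNorm_nonneg _).trans hUR
  have hd : U (n + 1) - V (n + 1) ∈ W := W.sub_mem (hU.1 _) (hV.1 _)
  refine gradNorm_step_sub_le hCq hlam hα0 hα1 (hW (hU.1 n)) (hW (hV.1 n)) (hW (hU.1 _))
    (hW (hV.1 _)) (by positivity) hδ (fun v hv => ?_) (hℓ _ hd) (hU.2 n _ hd) (hV.2 n _ hd)
  have h := mul_le_mul_of_nonneg_left
    (abs_bForm_sub_le hCq (hW (hU.1 n)) (hW (hV.1 n)) hv hUR hVR) hlam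
  exact h.trans_eq (by ring)

/-- Comparison with the zero sequence under zero load. Bounding b(u;·) itself instead of a
difference avoids the factor 2q+1, and this gain is what keeps the iterates in a ball. -/
theorem IsILGIteration.gradNorm_succ_le (hCq : IsSobolevConstant Ω Γ q Cq) (hlam : 0 ≤ lam)
    (hα0 : 0 ≤ α) (hα1 : α ≤ 1) (hW : W ≤ H1D Ω Γ) {ℓ : L2Pair Ω → ℝ}
    {U : ℕ → L2Pair Ω} (hU : IsILGIteration W q lam α ℓ U) {ρ R : ℝ} (hρ : 0 ≤ ρ)
    (hℓ : ∀ v ∈ W, |ℓ v| ≤ ρ * gradNorm v) {n : ℕ} (hUR : gradNorm (U n) ≤ R) :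
    gradNorm (U (n + 1))
      ≤ √((1 - α) ^ 2 + α ^ 2 * (lam * Cq ^ (2 * (q + 1)) * R ^ (2 * q)) ^ 2) * R + α * ρ := by
  have hC := hCq.1
  have hR0 : 0 ≤ R := (gradNorm_nonneg _).trans hUR
  have ha : ∀ v : L2Pair Ω, aForm (0 : L2Pair Ω) v = 0 := fun v => by simp [aForm_eq_inner]
  have hb : ∀ v : L2Pair Ω, bForm q (0 : L2Pair Ω) v = 0 := fun v => by
    refine (integral_congr_ae (g := fun _ => (0 : ℝ)) ?_).trans (by simp)
    filter_upwards [Lp.coeFn_zero ℝ 2 (volume.restrict Ω)] with x hx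
    have hx' : (0 : L2Pair Ω).1 x = 0 := hx
    simp only [hx']
    simp
  have h := gradNorm_step_sub_le (w := 0) (w' := 0) (ℓ := ℓ (U (n + 1))) (ℓ' := 0)
    (M := lam * Cq ^ (2 * (q + 1)) * R ^ (2 * q)) hCq hlam hα0 hα1 (hW (hU.1 n))
    (H1D Ω Γ).zero_mem (hW (hU.1 (n + 1))) (H1D Ω Γ).zero_mem (by positivity) hρ
    (fun v hv => by
      rw [hb, sub_zero, sub_zero]
      exact (mul_le_mul_of_nonneg_left (abs_bForm_le hCq (hW (hU.1 n)) hv hUR) hlam).trans_eq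
        (by ring))
    (by simpa using hℓ _ (hU.1 (n + 1)))
    (by simpa using hU.2 n _ (hU.1 (n + 1)))
    (by simp [ha, hb])
  rw [sub_zero, sub_zero] at h
  exact h.trans (by gcongr)

/-- The bound is the fixed point of x ↦ θx + s, and the recursion starts below it. -/
theorem le_div_of_geometric_recursion {e : ℕ → ℝ} {θ s : ℝ} (h0 : e 0 = 0) (hθ0 : 0 ≤ θ)
    (hθ : θ < 1) (hs : 0 ≤ s) (h : ∀ n, e (n + 1) ≤ θ * e n + s) (n : ℕ) :
    e n ≤ s / (1 - θ) := by
  have h1 : 0 < 1 - θ := by linarith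
  induction n with
  | zero => rw [h0]; positivity
  | succ n ih =>
    refine (h n).trans ?_
    have h2 : θ * e n ≤ θ * (s / (1 - θ)) := by gcongr
    have h3 : s / (1 - θ) = θ * (s / (1 - θ)) + s := by
      field_simp
      ring
    linarith

theorem sqrt_contraction_lt_one (hα : 0 < α) {M : ℝ} (hM : M ^ 2 < 2 / α - 1) :
    √((1 - α) ^ 2 + α ^ 2 * M ^ 2) < 1 := by
  rw [Real.sqrt_lt' one_pos]
  have h : α ^ 2 * M ^ 2 < α ^ 2 * (2 / α - 1) := by gcongr
  have h2 : α ^ 2 * (2 / α - 1) = 2 * α - α ^ 2 := by field_simp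
  nlinarith

/-- The iteration depends Lipschitz continuously on the load, with a constant that depends only on
`α` and not on how close `α` is to the bound `2 / (L ^ 2 + 1)`; small perturbations of the load
need not preserve that bound. -/
theorem exists_stability_constant (hCq : IsSobolevConstant Ω Γ q Cq) (hlam : 0 < lam)
    (hα0 : 0 < α) (hα1 : α ≤ 1) :
    ∃ K ε : ℝ, 0 < K ∧ 0 < ε ∧
      ∀ (W : Submodule ℝ (L2Pair Ω)) (ℓ ℓ' : L2Pair Ω → ℝ) (U V : ℕ → L2Pair Ω) (ρ ρ' δ : ℝ),
        W ≤ H1D Ω Γ → IsILGIteration W q lam α ℓ U → IsILGIteration W q lam α ℓ' V →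
        U 0 = V 0 → 0 ≤ ρ → 0 ≤ ρ' → 0 ≤ δ →
        (∀ v ∈ W, |ℓ v| ≤ ρ * gradNorm v) → (∀ v ∈ W, |ℓ' v| ≤ ρ' * gradNorm v) →
        (∀ v ∈ W, |ℓ v - ℓ' v| ≤ δ * gradNorm v) →
        (lam * (2 * q + 1) * Cq ^ (2 * (q + 1)) * (2 * ρ + gradNorm (U 0)) ^ (2 * q)) ^ 2
          < 2 / α - 1 →
        (ρ' ≤ ρ + ε ∨
          (lam * (2 * q + 1) * Cq ^ (2 * (q + 1)) * (2 * ρ' + gradNorm (U 0)) ^ (2 * q)) ^ 2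
            < 2 / α - 1) →
        ∀ n, gradNorm (U n - V n) ≤ K * δ := by
  have hC := hCq.1
  set A : ℝ := lam * (2 * q + 1) * Cq ^ (2 * (q + 1)) with hA
  have hA0 : 0 < A := by positivity
  have hzero : ∀ {U V : ℕ → L2Pair Ω}, U 0 = V 0 → gradNorm (U 0 - V 0) = 0 := fun h => by
    rw [h, sub_self]
    exact norm_zero
  by_cases hq : q = 0
  -- For q = 0 the Lipschitz constant A does not depend on a radius: either it gives a contraction,
  -- or no data are admissible.
  · by_cases hAα : A ^ 2 < 2 / α - 1
    · have hθ := sqrt_contraction_lt_one hα0 hAα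
      set θ := √((1 - α) ^ 2 + α ^ 2 * A ^ 2) with hθd
      have hθ1 : 0 < 1 - θ := by linarith
      refine ⟨α / (1 - θ), 1, by positivity, one_pos, ?_⟩
      intro W ℓ ℓ' U V ρ ρ' δ hW hU hV h0 hρ hρ' hδ hℓ hℓ' hd hf hg n
      rw [div_mul_eq_mul_div]
      refine le_div_of_geometric_recursion (e := fun n => gradNorm (U n - V n)) (hzero h0)
        (Real.sqrt_nonneg _) hθ (by positivity) (fun n => ?_) n
      have h := hU.gradNorm_sub_succ_le hCq hlam.le hα0.le hα1 hW hV hδ hd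
        (le_max_left (gradNorm (U n)) (gradNorm (V n))) (le_max_right _ _)
      rw [← hA] at h
      simpa [hq] using h
    · refine ⟨1, 1, one_pos, one_pos, ?_⟩
      intro W ℓ ℓ' U V ρ ρ' δ hW hU hV h0 hρ hρ' hδ hℓ hℓ' hd hf
      exact absurd (by simpa [hq] using hf) hAα
  have hq1 : 1 ≤ q := Nat.one_le_iff_ne_zero.2 hq
  have h2q : 2 * q ≠ 0 := by omega
  have hα2 : 0 < 2 / α - 1 := by
    rw [sub_pos, lt_div_iff₀ hα0]
    linarith
  have hαα : α ^ 2 * (2 / α - 1) = 2 * α - α ^ 2 := by field_simp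
  -- the radius of the ball on which the Lipschitz constant is critical for `α`
  obtain ⟨R, hR0, hR⟩ : ∃ R : ℝ, 0 < R ∧ (A * R ^ (2 * q)) ^ 2 = 2 / α - 1 := by
    refine ⟨(√(2 / α - 1) / A) ^ (((2 * q : ℕ) : ℝ)⁻¹), by positivity, ?_⟩
    rw [Real.rpow_inv_natCast_pow (by positivity) h2q, mul_div_cancel₀ _ hA0.ne',
      Real.sq_sqrt hα2.le]
  -- Admissibility thereby becomes the radius bound 2ρ + ‖∇U₀‖ ≤ R.
  have hball : ∀ x : ℝ, (A * x ^ (2 * q)) ^ 2 < 2 / α - 1 → x ≤ R := by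
    intro x hx
    by_contra! h
    rw [← hR] at hx
    refine absurd hx (not_lt.2 ?_)
    gcongr
  set k : ℝ := √((1 - α) ^ 2 + α ^ 2 * (lam * Cq ^ (2 * (q + 1)) * R ^ (2 * q)) ^ 2) with hk
  have hk0 : 0 ≤ k := Real.sqrt_nonneg _
  -- As 2q+1 ≥ 3, the constant B without this factor satisfies 9B² ≤ 2/α - 1; together with α ≤ 1
  -- this gives k² < (1 - α/2)².
  have hkα : k < 1 - α / 2 := by
    rw [hk, Real.sqrt_lt' (by linarith)]
    set B := lam * Cq ^ (2 * (q + 1)) * R ^ (2 * q) with hB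
    have h1 : (2 * (q : ℝ) + 1) ^ 2 * B ^ 2 = 2 / α - 1 := by
      rw [← hR, hA, hB]
      ring
    have hq1' : (1 : ℝ) ≤ q := by exact_mod_cast hq1
    have h2 : 9 * B ^ 2 ≤ 2 / α - 1 := by
      rw [← h1]
      have : (9 : ℝ) ≤ (2 * (q : ℝ) + 1) ^ 2 := by nlinarith
      gcongr
    have h3 : α ^ 2 * (9 * B ^ 2) ≤ 2 * α - α ^ 2 := by
      rw [← hαα]
      gcongr
    nlinarith
  -- The midpoint of 1 and k + α/2: half of the slack 1 - k - α/2 pays for the perturbation ε of ρ,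
  -- the other half shrinks the ball.
  set τ : ℝ := (1 + k + α / 2) / 2 with hτ
  have hτ0 : 0 ≤ τ := by positivity
  have hτ1 : τ < 1 := by rw [hτ]; linarith
  have hθ : √((1 - α) ^ 2 + α ^ 2 * (A * (τ * R) ^ (2 * q)) ^ 2) < 1 := by
    refine sqrt_contraction_lt_one hα0 ?_
    have h1 : (A * (τ * R) ^ (2 * q)) ^ 2 = (τ ^ (2 * q)) ^ 2 * (2 / α - 1) := by
      rw [← hR, mul_pow τ R]
      ring
    rw [h1]
    refine mul_lt_of_lt_one_left hα2 (pow_lt_one₀ (by positivity) ?_ two_ne_zero)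
    exact pow_lt_one₀ hτ0 hτ1 h2q
  set θ := √((1 - α) ^ 2 + α ^ 2 * (A * (τ * R) ^ (2 * q)) ^ 2) with hθd
  have hθ1 : 0 < 1 - θ := by linarith
  have hε : 0 < R * (1 - k - α / 2) / 2 := by
    have : 0 < 1 - k - α / 2 := by linarith
    positivity
  refine ⟨α / (1 - θ), R * (1 - k - α / 2) / 2, by positivity, hε, ?_⟩
  intro W ℓ ℓ' U V ρ ρ' δ hW hU hV h0 hρ hρ' hδ hℓ hℓ' hd hf hg n
  have hU0 := gradNorm_nonneg (U 0)
  have hfR := hball _ hf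
  -- By kR + αρ ≤ τR, every iterate after the first lies in the τR-ball; the initial guess is only
  -- known to lie in the R-ball.
  have hmap : ∀ {ℓ : L2Pair Ω → ℝ} {U : ℕ → L2Pair Ω} {ρ : ℝ}, IsILGIteration W q lam α ℓ U →
      0 ≤ ρ → (∀ v ∈ W, |ℓ v| ≤ ρ * gradNorm v) → gradNorm (U 0) ≤ R →
      ρ ≤ R / 2 + R * (1 - k - α / 2) / 2 → ∀ n, gradNorm (U (n + 1)) ≤ τ * R := by
    intro ℓ U ρ hU hρ hℓ h0 hρR n
    have step : ∀ n, gradNorm (U n) ≤ R → gradNorm (U (n + 1)) ≤ τ * R := by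
      intro n hn
      refine (hU.gradNorm_succ_le hCq hlam.le hα0.le hα1 hW hρ hℓ hn).trans ?_
      have h1 : α * ρ ≤ α * (R / 2) + R * (1 - k - α / 2) / 2 := by
        have := mul_le_mul_of_nonneg_left hρR hα0.le
        have := mul_le_mul_of_nonneg_right hα1 hε.le
        linarith
      have h2 : τ * R = k * R + (α * (R / 2) + R * (1 - k - α / 2) / 2) := by
        rw [hτ]
        ring
      linarith
    induction n with
    | zero => exact step 0 h0
    | succ n ih => exact step _ (ih.trans (mul_le_of_le_one_left hR0.le hτ1.le))
  have hUτ := hmap hU hρ hℓ (by linarith) (by linarith)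
  have hVτ := hmap hV hρ' hℓ' (by rw [← h0]; linarith) (by
    rcases hg with hg | hg
    · linarith
    · have := hball _ hg
      linarith)
  rw [div_mul_eq_mul_div]
  refine le_div_of_geometric_recursion (e := fun n => gradNorm (U n - V n)) (hzero h0)
    (Real.sqrt_nonneg _) hθ (by positivity) (fun n => ?_) n
  -- At n = 0 the iterates may lie outside the τR-ball, but they coincide, so the contraction factor
  -- is irrelevant and the error after the step is at most αδ.
  cases n with
  | zero =>
    have h := hU.gradNorm_sub_succ_le hCq hlam.le hα0.le hα1 hW hV hδ hd (n := 0)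
      (le_max_left (gradNorm (U 0)) (gradNorm (V 0))) (le_max_right _ _)
    simp only [hzero h0, mul_zero] at h ⊢
    exact h
  | succ n => exact hU.gradNorm_sub_succ_le hCq hlam.le hα0.le hα1 hW hV hδ hd (hUτ n) (hVτ n)

/-- The step size condition solved for L², the form in which it meets the contraction factor. -/
theorem StepSize.lipschitz_sq_lt {f : Plane → ℝ} {U₀ : L2Pair Ω} (h : StepSize q lam Cq f U₀ α) :
    (lam * (2 * q + 1) * Cq ^ (2 * (q + 1)) * (2 * rho Ω q Cq f + gradNorm U₀) ^ (2 * q)) ^ 2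
      < 2 / α - 1 := by
  obtain ⟨h0, -, h2⟩ := h
  rw [lt_div_iff₀ (by positivity)] at h2
  rw [lt_sub_iff_add_lt, lt_div_iff₀ h0, mul_comm]
  exact h2

/-! ### The source and its approximation -/

theorem rho_nonneg (hCq : 0 ≤ Cq) (f : Plane → ℝ) : 0 ≤ rho Ω q Cq f :=
  mul_nonneg hCq ENNReal.toReal_nonneg

theorem memLp_dualExponent [IsFiniteMeasure (volume.restrict Ω)] {f : Plane → ℝ}
    (hf : MemLp f 2 (volume.restrict Ω)) :
    MemLp f (ENNReal.ofReal (2 * ((q : ℝ) + 1) / (2 * q + 1))) (volume.restrict Ω) :=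
  hf.mono_exponent (dualExponent_le_two q)

theorem rho_le_rho_add_rho_sub [IsFiniteMeasure (volume.restrict Ω)] (hCq : 0 ≤ Cq)
    {f g : Plane → ℝ} (hf : MemLp f 2 (volume.restrict Ω)) (hg : MemLp g 2 (volume.restrict Ω)) :
    rho Ω q Cq g ≤ rho Ω q Cq f + rho Ω q Cq fun x => f x - g x := by
  have hf' := memLp_dualExponent (q := q) hf
  have hd' := memLp_dualExponent (q := q) (hf.sub hg)
  change _ ≤ Cq * _ + Cq * (eLpNorm (f - g) _ _).toReal
  rw [rho, ← mul_add, ← ENNReal.toReal_add hf'.2.ne hd'.2.ne]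
  refine mul_le_mul_of_nonneg_left (ENNReal.toReal_mono
    (ENNReal.add_ne_top.2 ⟨hf'.2.ne, hd'.2.ne⟩) ?_) hCq
  have h := eLpNorm_sub_le (p := ENNReal.ofReal (2 * ((q : ℝ) + 1) / (2 * q + 1))) hf'.1 hd'.1
    (by
      rw [ENNReal.one_le_ofReal, le_div_iff₀ (by positivity)]
      linarith)
  rwa [sub_sub_cancel] at h

/-- `ρ` is bounded by the norm of `L²(Ω)`. -/
theorem exists_rho_le [IsFiniteMeasure (volume.restrict Ω)] (hCq : 0 ≤ Cq) :
    ∃ K : ℝ, 0 < K ∧ ∀ (h : Plane → ℝ) (η : ℝ), 0 ≤ η → AEStronglyMeasurable h (volume.restrict Ω) →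
      eLpNorm h 2 (volume.restrict Ω) ≤ ENNReal.ofReal η → rho Ω q Cq h ≤ K * η := by
  set s : ℝ := 1 / (ENNReal.ofReal (2 * ((q : ℝ) + 1) / (2 * q + 1))).toReal
    - 1 / (2 : ℝ≥0∞).toReal with hs
  have hs0 : 0 ≤ s := by
    rw [hs, sub_nonneg]
    refine one_div_le_one_div_of_le ?_ (ENNReal.toReal_mono (by simp) (dualExponent_le_two q))
    exact ENNReal.toReal_pos (by simp; positivity) (by simp)
  set m := volume.restrict Ω univ ^ s with hm
  have hmt : m ≠ ⊤ := ENNReal.rpow_ne_top_of_nonneg hs0 (measure_ne_top _ _)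
  refine ⟨Cq * m.toReal + 1, by positivity, fun h η hη hh hle => ?_⟩
  have h1 := (eLpNorm_le_eLpNorm_mul_rpow_measure_univ (dualExponent_le_two q) hh).trans
    (mul_le_mul_left hle m)
  have h2 := ENNReal.toReal_mono (ENNReal.mul_ne_top ENNReal.ofReal_ne_top hmt) h1
  rw [ENNReal.toReal_mul, ENNReal.toReal_ofReal hη] at h2
  have h3 := mul_le_mul_of_nonneg_left h2 hCq
  unfold rho
  linarith

theorem exactLoad_sub {f g : Plane → ℝ} (hf : MemLp f 2 (volume.restrict Ω))
    (hg : MemLp g 2 (volume.restrict Ω)) (v : L2Pair Ω) :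
    exactLoad (fun x => f x - g x) v = exactLoad f v - exactLoad g v := by
  have hf' : Integrable (fun x => f x * v.1 x) (volume.restrict Ω) :=
    hf.integrable_mul (q := 2) (Lp.memLp v.1)
  have hg' : Integrable (fun x => g x * v.1 x) (volume.restrict Ω) :=
    hg.integrable_mul (q := 2) (Lp.memLp v.1)
  unfold exactLoad
  rw [← integral_sub hf' hg']
  simp only [sub_mul]

theorem hpSpace_le_H1D (𝒯 : Finset (Finset Plane)) (p : ℕ) : hpSpace Ω Γ 𝒯 p ≤ H1D Ω Γ :=
  fun _ hv => hv.1

theorem exists_exp_neg_rpow_le {C c ε : ℝ} (hc : 0 < c) (hε : 0 < ε) :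
    ∃ N₀ : ℕ, ∀ N : ℕ, N₀ ≤ N → C * Real.exp (-c * (N : ℝ) ^ (1 / 3 : ℝ)) ≤ ε := by
  have h : Filter.Tendsto (fun N : ℕ => C * Real.exp (-c * (N : ℝ) ^ (1 / 3 : ℝ)))
      Filter.atTop (nhds (C * 0)) := by
    refine Filter.Tendsto.const_mul C (Real.tendsto_exp_atBot.comp ?_)
    refine Filter.Tendsto.const_mul_atTop_of_neg (by linarith) ?_
    exact (tendsto_rpow_atTop (by norm_num)).comp tendsto_natCast_atTop_atTop
  rw [mul_zero] at h
  exact Filter.eventually_atTop.1 (h.eventually_le_const hε)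

end HpILG
end

/-! ### The exponential bound, uniform in the mesh and the iteration index. -/

theorem lemma4p4
    {m : ℕ} [NeZero m] (Ω : Set HpILG.Plane) (c : Fin m → HpILG.Plane)
    (hΩ : HpILG.IsPolygon Ω c)
    (D : Finset (Fin m)) (hD : D.Nonempty)
    (q : ℕ) (lam : ℝ) (hlam : 0 < lam)
    (Cq : ℝ) (hCq : HpILG.IsSobolevConstant Ω (HpILG.dirichletPart c D) q Cq)
    -- the meshes, with polynomial degrees `p = 1, 2, …`
    (𝒯 : ℕ → Finset (Finset HpILG.Plane))
    (h𝒯 : ∀ p, 1 ≤ p → HpILG.IsRegularPartition Ω (𝒯 p))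
    -- the source, its approximations `g p = Π_p(f)` and their polynomial degrees `d p`
    (f : HpILG.Plane → ℝ) (g : ℕ → HpILG.Plane → ℝ) (d : ℕ → ℕ)
    (hfg : HpILG.IsExpApprox Ω (HpILG.dirichletPart c D) 𝒯 f g d)
    -- the elementwise quadrature rules
    (Q : ℕ → (T : Finset HpILG.Plane) → HpILG.QuadratureRule T)
    (hQ : ∀ p, 1 ≤ p → ∀ T ∈ 𝒯 p, (Q p T).IsExact (d p + p))
    (α : ℝ) :
    ∃ (C κ : ℝ) (N₀ : ℕ), 0 < C ∧ 0 < κ ∧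
      ∀ p, 1 ≤ p → ∀ U V : ℕ → HpILG.L2Pair Ω,
        HpILG.IsILGIteration (HpILG.hpSpace Ω (HpILG.dirichletPart c D) (𝒯 p) p) q lam α
          (HpILG.exactLoad f) U →
        HpILG.IsILGIteration (HpILG.hpSpace Ω (HpILG.dirichletPart c D) (𝒯 p) p) q lam α
          (HpILG.quadratureLoad (𝒯 p) (Q p) (d p) p (g p)) V →
        U 0 = V 0 →
        HpILG.StepSize q lam Cq f (U 0) α →
        (N₀ ≤ HpILG.dofs Ω (HpILG.dirichletPart c D) (𝒯 p) p ∨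
          HpILG.StepSize q lam Cq (g p) (U 0) α) →
        ∀ n, HpILG.gradNorm (U n - V n) ≤
          C * Real.exp
            (-κ * (HpILG.dofs Ω (HpILG.dirichletPart c D) (𝒯 p) p : ℝ) ^ (1 / 3 : ℝ)) := by
  obtain hα | hα := em (0 < α ∧ α ≤ 1)
  swap
  -- Outside (0, 1] no α is admissible, so any constants do.
  · exact ⟨1, 1, 0, one_pos, one_pos, fun p _ U V _ _ _ h => absurd ⟨h.1, h.2.1⟩ hα⟩
  obtain ⟨C', κ, hC', hκ, hrate⟩ := hfg.rate
  have : Fact (MeasureTheory.volume Ω < ⊤) := ⟨hΩ.isBounded.measure_lt_top⟩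
  obtain ⟨K₁, hK₁, hrho⟩ := HpILG.exists_rho_le (Ω := Ω) (q := q) hCq.1.le
  obtain ⟨K₂, ε, hK₂, hε, hstab⟩ := HpILG.exists_stability_constant hCq hlam hα.1 hα.2
  -- From N₀ on, ρ(f - Π_p f) is at most ε, the tolerance of the stability result.
  obtain ⟨N₀, hN₀⟩ := HpILG.exists_exp_neg_rpow_le (C := K₁ * C') hκ hε
  refine ⟨K₂ * (K₁ * C'), κ, N₀, by positivity, hκ, ?_⟩
  intro p hp U V hU hV h0 hf hg n
  have hgm := (h𝒯 p hp).aestronglyMeasurable (hfg.elementwise p hp)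
  have hsub : MeasureTheory.MemLp (fun x => f x - g p x) 2 (MeasureTheory.volume.restrict Ω) :=
    ⟨hfg.memLp.1.sub hgm, (hrate p hp).trans_lt ENNReal.ofReal_lt_top⟩
  -- Square integrability of Π_p f follows from that of f and the finite approximation error.
  have hgL : MeasureTheory.MemLp (g p) 2 (MeasureTheory.volume.restrict Ω) := by
    have h : (fun x => f x - (f x - g p x)) = g p := by
      ext x
      ring
    rw [← h]
    exact hfg.memLp.sub hsub
  have hδ := hrho _ _ (by positivity) hsub.1 (hrate p hp)
  rw [← mul_assoc] at hδ
  have hload : ∀ v ∈ HpILG.hpSpace Ω (HpILG.dirichletPart c D) (𝒯 p) p,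
      HpILG.quadratureLoad (𝒯 p) (Q p) (d p) p (g p) v = HpILG.exactLoad (g p) v := fun v hv =>
    HpILG.quadratureLoad_eq_exactLoad hΩ (h𝒯 p hp) (hfg.elementwise p hp) hgL (hQ p hp) hv
  have hC := hCq.1.le
  refine (hstab _ _ _ U V (HpILG.rho Ω q Cq f) (HpILG.rho Ω q Cq (g p))
    (HpILG.rho Ω q Cq fun x => f x - g p x) (HpILG.hpSpace_le_H1D _ _) hU hV h0 (HpILG.rho_nonneg hC _)
    (HpILG.rho_nonneg hC _) (HpILG.rho_nonneg hC _) ?_ ?_ ?_ hf.lipschitz_sq_lt ?_ n).trans ?_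
  · exact fun v hv => HpILG.abs_exactLoad_le hCq (HpILG.memLp_dualExponent hfg.memLp) hv.1
  · intro v hv
    rw [hload v hv]
    exact HpILG.abs_exactLoad_le hCq (HpILG.memLp_dualExponent hgL) hv.1
  · intro v hv
    have h := HpILG.abs_exactLoad_le hCq (HpILG.memLp_dualExponent hsub) hv.1
    rwa [hload v hv, ← HpILG.exactLoad_sub hfg.memLp hgL]
  · refine hg.imp (fun hN => ?_) fun h => h.lipschitz_sq_lt
    exact (HpILG.rho_le_rho_add_rho_sub hC hfg.memLp hgL).trans
      (by linarith [hδ.trans (hN₀ _ hN)])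
  · rw [mul_assoc]
    exact mul_le_mul_of_nonneg_left hδ hK₂.le
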